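/- Let $(X,\lambda)$ be a standard $\sigma$-finite space, that is, an uncountable standard Borel space $X$ endowed with a nonzero atomless $\sigma$-finite Borel measure $\lambda$. Let $G$ be a locally compact Polish group, and let $\alpha$ be a boolean measure-preserving $G$-action on $(X,\lambda)$, i.e. a Borel map $\alpha: G\times X\to X$ such that (i) for all $g,h\in G$, we have $\alpha(gh,x)=\alpha(g,\alpha(h,x))$ for $\lambda$-almost every $x\in X$; (ii) for all $g\in G$, the map $\alpha(g,\cdot): X\to X$ is a bijection with $\lambda(\alpha(g,\cdot)^{-1}(A))=\lambda(A)$ for every Borel set $A\subseteq X$. Then $\alpha$ admits a continuous Radon model: there exist a locally compact Polish space $Y$, a Radon measure $\eta$ on $Y$ (a Borel measure that is finite on compact sets, inner regular with respect to compact sets on open sets, and outer regular on Borel sets) such that $(Y,\eta)$ is a standard $\sigma$-finite space, and a continuous action $\beta: G\times Y\to Y$ preserving $\eta$, such that $\alpha$ and $\beta$ are booleanly isomorphic. The latter means that there are a Borel set $X_0\subseteq X$ with $\lambda(X\setminus X_0)=0$ and an injective Borel map $\Phi: X_0\to Y$ with $\lambda(\Phi^{-1}(B))=\eta(B)$ for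 every Borel set $B\subseteq Y$, such that for every $g\in G$ there is a Borel set $X_g\subseteq X_0$ with $\lambda(X\setminus X_g)=0$, $\alpha(g,x)\in X_0$ and $\Phi(\alpha(g,x))=\beta(g,\Phi(x))$ for all $x\in X_g$. -/

import Mathlib

open MeasureTheory

universe u v

/-- A standard `σ`-finite space: an uncountable standard Borel space with a nontrivial atomless
`σ`-finite measure. (On a standard Borel space, a `σ`-finite measure is atomless if and only if
singletons are null, which is what `NullSingletonClass` says.) -/
structure IsStandardSigmaFinite {X : Type u} [MeasurableSpace X] (μ : Measure X) : Prop where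
  standardBorel : StandardBorelSpace X
  uncountable : Uncountable X
  sigmaFinite : SigmaFinite μ
  atomless : NullSingletonClass μ
  ne_zero : μ ≠ 0

/-- A boolean measure-preserving action of `G` on `(X, μ)`: a Borel map `G × X → X` such that every
`α g` is a measure-preserving bijection of `X`, and for all `g, h` the identity
`α (g * h) x = α g (α h x)` holds for almost every `x` (the null set may depend on `g, h`). -/
structure IsBooleanAction {G : Type v} {X : Type u} [Group G] [MeasurableSpace G]
    [MeasurableSpace X] (μ : Measure X) (α : G → X → X) : Prop where
  measurable : Measurable (fun p : G × X => α p.1 p.2)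
  mul_ae : ∀ g h : G, ∀ᵐ x ∂μ, α (g * h) x = α g (α h x)
  bijective : ∀ g : G, Function.Bijective (α g)
  measurePreserving : ∀ g : G, MeasurePreserving (α g) μ μ

/-- A boolean isomorphism between the actions `α` on `(X, μ)` and `β` on `(Y, ν)`: a
measure-preserving Borel injection `Φ : X₀ → Y` on a conull Borel set `X₀ ⊆ X` such that for each
`g` there is a conull Borel set `X_g ⊆ X₀` with `α g x ∈ X₀` and `Φ (α g x) = β g (Φ x)` for all
`x ∈ X_g`. Here `X₀` carries the restriction of `μ`. -/
structure IsBooleanIso {G : Type v} {X Y : Type u} [MeasurableSpace X] [MeasurableSpace Y]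
    (μ : Measure X) (ν : Measure Y) (α : G → X → X) (β : G → Y → Y)
    (X₀ : Set X) (Φ : X₀ → Y) : Prop where
  measurableSet : MeasurableSet X₀
  conull : μ X₀ᶜ = 0
  injective : Function.Injective Φ
  measurePreserving : MeasurePreserving Φ (μ.comap Subtype.val) ν
  equivariant : ∀ g : G, ∃ Xg : Set X, Xg ⊆ X₀ ∧ MeasurableSet Xg ∧ μ Xgᶜ = 0 ∧
    ∀ x ∈ Xg, ∃ (hx : x ∈ X₀) (hgx : α g x ∈ X₀), Φ ⟨α g x, hgx⟩ = β g (Φ ⟨x, hx⟩)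

/-- Two actions are booleanly isomorphic if there is a boolean isomorphism between them. -/
def BooleanlyIsomorphic {G : Type v} {X Y : Type u} [MeasurableSpace X] [MeasurableSpace Y]
    (μ : Measure X) (ν : Measure Y) (α : G → X → X) (β : G → Y → Y) : Prop :=
  ∃ (X₀ : Set X) (Φ : X₀ → Y), IsBooleanIso μ ν α β X₀ Φ

/-- `(Y, η)` with its `G`-action is a continuous Radon model of the boolean action `α` on `(X, μ)`:
`Y` is a locally compact Polish space with its Borel `σ`-algebra, `η` is a Radon measure making `Y`
a standard `σ`-finite space, the action of `G` on `Y` is (jointly) continuous and preserves `η`, and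
it is booleanly isomorphic to `α`. (`Measure.Regular` says: finite on compact sets, outer regular on
Borel sets, inner regular for compact sets on open sets.) -/
structure IsContinuousRadonModel {G : Type v} {X : Type u} [Group G] [TopologicalSpace G]
    [MeasurableSpace X] (μ : Measure X) (α : G → X → X)
    (Y : Type u) [TopologicalSpace Y] [MeasurableSpace Y] [MulAction G Y] (η : Measure Y) :
    Prop where
  polish : PolishSpace Y
  locallyCompact : LocallyCompactSpace Y
  borel : BorelSpace Y
  standard : IsStandardSigmaFinite η
  radon : η.Regular
  continuousSMul : ContinuousSMul G Y
  measurePreserving : ∀ g : G, MeasurePreserving (fun y : Y => g • y) η η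
  iso : BooleanlyIsomorphic μ η α (fun (g : G) (y : Y) => g • y)

/-! Choose an injective integrable `f : X → (0,1]` and send `x` to its orbit function `g ↦ f (α g⁻¹
x)`, read as a point of the weak-* unit ball of the dual of `L¹(G, Haar)`. The ball is compact and
metrizable, so removing `0` leaves a locally compact Polish space. Translation acts on it
continuously, because `G` acts on `L¹` continuously and by isometries. The orbit functions are
positive, hence nonzero, and they determine `x`. Fubini turns the almost everywhere action law into
almost everywhere equivariance (`IsBooleanAction.ae_ae_orbit_eq`). Fubini and invariance of `μ` make
each coefficient `x ↦ Φ x φ` integrable, so `{|Φ x φ| > c}` has finite measure for `c > 0`. Such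
sets cover the punctured ball, so the push-forward of `μ` is locally finite, hence Radon
(`isContinuousRadonModel_map`). -/

/-- A `σ`-finite measure on a standard Borel space admits an injective integrable function with
values in `(0, 1]`. -/
theorem exists_injective_integrable {X : Type*} [MeasurableSpace X] [StandardBorelSpace X]
    (μ : Measure X) [SigmaFinite μ] :
    ∃ f : X → ℝ, Measurable f ∧ Function.Injective f ∧ (∀ x, 0 < f x) ∧ (∀ x, f x ≤ 1) ∧
      Integrable f μ := by
  obtain ⟨w, hw0, hwm, hwi⟩ := exists_pos_lintegral_lt_of_sigmaFinite μ one_ne_zero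
  let e : X → ℝ := fun x => Real.sigmoid (embeddingReal X x)
  have hem : Measurable e :=
    continuous_sigmoid.measurable.comp (measurableEmbedding_embeddingReal X).measurable
  have hei : Function.Injective e :=
    Real.sigmoid_injective.comp (measurableEmbedding_embeddingReal X).injective
  have he0 : ∀ x, 0 ≤ e x := fun x => Real.sigmoid_nonneg _
  have he1 : ∀ x, e x < 1 := fun x => Real.sigmoid_lt_one _
  have hw0' : ∀ x, (0 : ℝ) < (w x : ℝ)⁻¹ := fun x => by have := hw0 x; positivity
  -- The function is `1 / (n + e)`: the integer part `n ≥ 1 / w` forces the bound by `w`, and the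
  -- fractional part `e` recovers the point.
  let n : X → ℕ := fun x => ⌈(w x : ℝ)⁻¹⌉₊
  have hn : ∀ x, (1 : ℝ) ≤ n x := fun x => by exact_mod_cast Nat.ceil_pos.2 (hw0' x)
  have hden : ∀ x, 1 ≤ (n x : ℝ) + e x := fun x => by linarith [hn x, he0 x]
  have hm : Measurable fun x => ((n x : ℝ) + e x)⁻¹ := by
    have : Measurable n := Nat.measurable_ceil.comp hwm.coe_nnreal_real.inv
    exact ((measurable_from_nat (f := fun k : ℕ => (k : ℝ))).comp this |>.add hem).inv
  have hpos : ∀ x, 0 < ((n x : ℝ) + e x)⁻¹ := fun x => inv_pos.2 (by linarith [hden x])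
  refine ⟨fun x => ((n x : ℝ) + e x)⁻¹, hm, fun x y hxy => ?_, hpos,
    fun x => inv_le_one_of_one_le₀ (hden x), ?_⟩
  · have h := congrArg Int.fract (inv_injective hxy)
    rw [Int.fract_natCast_add, Int.fract_natCast_add, Int.fract_eq_self.2 ⟨he0 x, he1 x⟩,
      Int.fract_eq_self.2 ⟨he0 y, he1 y⟩] at h
    exact hei h
  · have hwint : Integrable (fun x => (w x : ℝ)) μ := by
      refine ⟨hwm.coe_nnreal_real.aestronglyMeasurable, ?_⟩
      simpa [HasFiniteIntegral] using hwi.trans ENNReal.one_lt_top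
    refine hwint.mono' hm.aestronglyMeasurable (.of_forall fun x => ?_)
    rw [Real.norm_of_nonneg (hpos x).le]
    exact inv_le_of_inv_le₀ (by exact_mod_cast hw0 x)
      ((Nat.le_ceil _).trans (le_add_of_nonneg_right (he0 x)))

/-! ### Weak-* dual balls and the action on them -/

/-- The unit ball of the dual of a real normed space, with the weak-* topology. -/
abbrev WeakDualBall (E : Type*) [NormedAddCommGroup E] [NormedSpace ℝ E] : Type _ :=
  {ℓ : WeakDual ℝ E // ∀ φ, ‖ℓ φ‖ ≤ ‖φ‖}

/-- The nonzero elements of the unit ball of the dual, with the weak-* topology. -/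
abbrev PuncturedWeakDualBall (E : Type*) [NormedAddCommGroup E] [NormedSpace ℝ E] : Type _ :=
  {ℓ : WeakDualBall E // ℓ.1 ≠ 0}

namespace WeakDualBall

variable {E : Type*} [NormedAddCommGroup E] [NormedSpace ℝ E]

instance compactSpace : CompactSpace (WeakDualBall E) := by
  refine isCompact_iff_compactSpace (s := {ℓ : WeakDual ℝ E | ∀ φ, ‖ℓ φ‖ ≤ ‖φ‖}).1 ?_
  convert WeakDual.isCompact_closedBall (𝕜 := ℝ) (E := E) 0 1 using 1
  ext ℓ
  simp only [Set.mem_ofPred_eq, Set.mem_preimage, mem_closedBall_zero_iff]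
  refine ⟨fun h => ContinuousLinearMap.opNorm_le_bound _ zero_le_one fun φ => ?_, fun h φ => ?_⟩
  · simpa using h φ
  · simpa using ContinuousLinearMap.le_of_opNorm_le (WeakDual.toStrongDual ℓ) h φ

theorem continuous_eval (φ : E) : Continuous fun ℓ : WeakDualBall E => ℓ.1 φ :=
  (WeakDual.eval_continuous φ).comp continuous_subtype_val

/-- On the unit ball, evaluation is jointly continuous. -/
theorem continuous_eval_prod : Continuous fun p : WeakDualBall E × E => p.1.1 p.2 := by
  rw [continuous_iff_continuousAt]
  rintro ⟨ℓ, φ⟩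
  have h₁ : Filter.Tendsto (fun p : WeakDualBall E × E => p.1.1 φ) (nhds (ℓ, φ)) (nhds (ℓ.1 φ)) :=
    ((continuous_eval φ).comp continuous_fst).tendsto (ℓ, φ)
  -- Functionals in the ball are uniformly 1-Lipschitz; this equicontinuity gives joint continuity.
  have h₂ : Filter.Tendsto (fun p : WeakDualBall E × E => p.1.1 (p.2 - φ)) (nhds (ℓ, φ))
      (nhds 0) := by
    refine squeeze_zero_norm (a := fun p => ‖p.2 - φ‖) (fun p => p.1.2 _) ?_
    have : Continuous fun p : WeakDualBall E × E => ‖p.2 - φ‖ := by fun_prop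
    simpa using this.tendsto (ℓ, φ)
  have h := h₁.add h₂
  rw [add_zero] at h
  exact h.congr fun p => by rw [← map_add, add_sub_cancel]

variable [TopologicalSpace.SeparableSpace E]

/-- Evaluations at a dense sequence embed the unit ball of the dual into `ℕ → ℝ`. -/
theorem isClosedEmbedding_eval_denseSeq :
    Topology.IsClosedEmbedding
      fun (ℓ : WeakDualBall E) (n : ℕ) => ℓ.1 (TopologicalSpace.denseSeq E n) := by
  refine (continuous_pi fun n => continuous_eval _).isClosedEmbedding fun ℓ ℓ' h => ?_
  refine Subtype.ext (DFunLike.coe_injective ?_)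
  refine (TopologicalSpace.denseRange_denseSeq E).equalizer ℓ.1.continuous ℓ'.1.continuous ?_
  exact h

instance polishSpace : PolishSpace (WeakDualBall E) :=
  isClosedEmbedding_eval_denseSeq.polishSpace

end WeakDualBall

theorem norm_smul_of_isIsometricSMul {M E : Type*} [Monoid M] [NormedAddCommGroup E]
    [DistribMulAction M E] [IsIsometricSMul M E] (c : M) (φ : E) : ‖c • φ‖ = ‖φ‖ := by
  simpa using dist_smul c φ 0

namespace PuncturedWeakDualBall

variable {E : Type*} [NormedAddCommGroup E] [NormedSpace ℝ E]

theorem isOpen_setOf_ne_zero : IsOpen {ℓ : WeakDualBall E | ℓ.1 ≠ 0} :=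
  isOpen_ne.preimage continuous_subtype_val

instance locallyCompactSpace : LocallyCompactSpace (PuncturedWeakDualBall E) :=
  isOpen_setOf_ne_zero.isLocallyClosed.locallyCompactSpace

theorem exists_apply_ne_zero (ℓ : PuncturedWeakDualBall E) : ∃ φ, ℓ.1.1 φ ≠ 0 := by
  by_contra! h
  exact ℓ.2 (DFunLike.ext _ _ h)

section Separable

variable [TopologicalSpace.SeparableSpace E]

instance polishSpace : PolishSpace (PuncturedWeakDualBall E) :=
  isOpen_setOf_ne_zero.polishSpace

theorem isEmbedding_eval_denseSeq :
    Topology.IsEmbedding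
      fun (ℓ : PuncturedWeakDualBall E) (n : ℕ) => ℓ.1.1 (TopologicalSpace.denseSeq E n) :=
  WeakDualBall.isClosedEmbedding_eval_denseSeq.isEmbedding.comp .subtypeVal

/-- `L¹(G)` lives in the universe of `G`, but the model must live in that of `X`. -/
instance small : Small.{u} (PuncturedWeakDualBall E) :=
  small_of_injective isEmbedding_eval_denseSeq.injective

theorem measurable_of_eval {X : Type*} [MeasurableSpace X]
    [MeasurableSpace (PuncturedWeakDualBall E)] [BorelSpace (PuncturedWeakDualBall E)]
    {Φ : X → PuncturedWeakDualBall E} (h : ∀ φ, Measurable fun x => (Φ x).1.1 φ) :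
    Measurable Φ := by
  have hb : ‹MeasurableSpace (PuncturedWeakDualBall E)› = MeasurableSpace.comap
      (fun (ℓ : PuncturedWeakDualBall E) (n : ℕ) => ℓ.1.1 (TopologicalSpace.denseSeq E n))
      inferInstance := by
    rw [BorelSpace.measurable_eq (α := PuncturedWeakDualBall E),
      isEmbedding_eval_denseSeq.eq_induced, borel_comap, ← BorelSpace.measurable_eq (α := ℕ → ℝ)]
  rw [hb, measurable_comap_iff]
  exact measurable_pi_lambda _ fun n => h _

end Separable

section Action

variable {G : Type*} [Group G] [DistribMulAction Gᵈᵐᵃ E] [SMulCommClass Gᵈᵐᵃ ℝ E]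
  [IsIsometricSMul Gᵈᵐᵃ E]

/-- A linear isometric action on the domain `E` induces an action on the punctured unit ball
of the dual. -/
noncomputable instance mulAction : MulAction G (PuncturedWeakDualBall E) where
  smul g ℓ := ⟨⟨(WeakDual.toStrongDual ℓ.1.1).comp
      { toLinearMap := DistribSMul.toLinearMap ℝ E (DomMulAct.mk g)
        cont := (isometry_smul E (DomMulAct.mk g)).continuous },
      fun φ => (ℓ.1.2 _).trans_eq (norm_smul_of_isIsometricSMul _ φ)⟩, fun h => by
        obtain ⟨φ, hφ⟩ := ℓ.exists_apply_ne_zero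
        refine hφ ?_
        have := DFunLike.congr_fun h ((DomMulAct.mk g)⁻¹ • φ)
        change ℓ.1.1 (DomMulAct.mk g • (DomMulAct.mk g)⁻¹ • φ) = 0 at this
        rwa [smul_inv_smul] at this⟩
  one_smul ℓ := by
    refine Subtype.ext (Subtype.ext (DFunLike.ext _ _ fun φ => ?_))
    exact congrArg ℓ.1.1 (one_smul Gᵈᵐᵃ φ)
  -- `DomMulAct.mk` reverses products, and dualizing reverses them again.
  mul_smul g h ℓ := by
    refine Subtype.ext (Subtype.ext (DFunLike.ext _ _ fun φ => ?_))
    exact congrArg ℓ.1.1 (mul_smul (DomMulAct.mk h) (DomMulAct.mk g) φ)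

theorem smul_apply (g : G) (ℓ : PuncturedWeakDualBall E) (φ : E) :
    (g • ℓ).1.1 φ = ℓ.1.1 (DomMulAct.mk g • φ) := rfl

instance continuousSMul [TopologicalSpace G] [ContinuousSMul Gᵈᵐᵃ E] :
    ContinuousSMul G (PuncturedWeakDualBall E) where
  continuous_smul := by
    refine Continuous.subtype_mk (Continuous.subtype_mk
      (WeakDual.continuous_of_continuous_eval fun φ => ?_) _) _
    have h : Continuous fun p : G × PuncturedWeakDualBall E =>
        ((p.2.1, DomMulAct.mk p.1 • φ) : WeakDualBall E × E) :=
      (continuous_subtype_val.comp continuous_snd).prodMk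
        ((DomMulAct.continuous_mk.comp continuous_fst).smul continuous_const)
    exact WeakDualBall.continuous_eval_prod.comp h

end Action

end PuncturedWeakDualBall

/-! ### From an equivariant map to a Radon model -/

/-- An injective Borel map into a locally compact Polish `G`-space that is almost everywhere
equivariant and for which the push-forward of the measure is locally finite gives a continuous
Radon model. -/
theorem isContinuousRadonModel_map {G : Type v} [Group G] [TopologicalSpace G]
    {X : Type u} [MeasurableSpace X] {μ : Measure X} (hμ : IsStandardSigmaFinite μ)
    {α : G → X → X} (hα : ∀ g, MeasurePreserving (α g) μ μ)
    {Y : Type u} [TopologicalSpace Y] [PolishSpace Y] [LocallyCompactSpace Y]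
    [MeasurableSpace Y] [BorelSpace Y] [MulAction G Y] [ContinuousSMul G Y]
    {Φ : X → Y} (hΦ : Measurable Φ) (hinj : Function.Injective Φ)
    (hequiv : ∀ g, ∀ᵐ x ∂μ, Φ (α g x) = g • Φ x)
    (hfin : ∀ y, ∃ U ∈ nhds y, IsOpen U ∧ μ (Φ ⁻¹' U) < ⊤) :
    IsContinuousRadonModel μ α Y (μ.map Φ) := by
  have := hμ.uncountable
  have := hμ.atomless
  let := TopologicalSpace.upgradeIsCompletelyMetrizable Y
  have hlf : IsLocallyFiniteMeasure (μ.map Φ) := ⟨fun y => by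
    obtain ⟨U, hU, hUo, h⟩ := hfin y
    exact ⟨U, hU, by rwa [Measure.map_apply hΦ hUo.measurableSet]⟩⟩
  have hsmul : ∀ g : G, Measurable fun y : Y => g • y := fun g =>
    (continuous_const_smul g).measurable
  refine
    { polish := inferInstance
      locallyCompact := inferInstance
      borel := inferInstance
      standard :=
        { standardBorel := inferInstance
          uncountable := hinj.uncountable
          sigmaFinite := inferInstance
          atomless := ⟨fun y => ?_⟩
          ne_zero := fun h => hμ.ne_zero ((Measure.map_eq_zero_iff hΦ.aemeasurable).1 h) }
      radon := inferInstance
      continuousSMul := inferInstance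
      measurePreserving := fun g => ⟨hsmul g, ?_⟩
      iso := ⟨Set.univ, fun x => Φ x, ?_⟩ }
  · rw [Measure.map_apply hΦ (measurableSet_singleton y)]
    exact (Set.subsingleton_singleton.preimage hinj).measure_zero μ
  · rw [Measure.map_map (hsmul g) hΦ]
    calc μ.map ((fun y : Y => g • y) ∘ Φ) = μ.map (Φ ∘ α g) :=
          Measure.map_congr ((hequiv g).mono fun x hx => hx.symm)
      _ = (μ.map (α g)).map Φ := (Measure.map_map hΦ (hα g).measurable).symm
      _ = μ.map Φ := by rw [(hα g).map_eq]
  · refine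
      { measurableSet := .univ
        conull := by simp
        injective := hinj.comp Subtype.val_injective
        measurePreserving := ?_
        equivariant := fun g => ⟨{x | Φ (α g x) = g • Φ x}, Set.subset_univ _,
          measurableSet_eq_fun (hΦ.comp (hα g).measurable) ((hsmul g).comp hΦ), hequiv g,
          fun x hx => ⟨trivial, trivial, hx⟩⟩ }
    have h := measurePreserving_subtype_coe (μa := μ) (MeasurableSet.univ)
    rw [Measure.restrict_univ] at h
    exact (hΦ.measurePreserving μ).comp h

/-- Universe-polymorphic version of `isContinuousRadonModel_map`: the target only needs to be
small. -/
theorem exists_isContinuousRadonModel_of_small {G : Type v} [Group G] [TopologicalSpace G]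
    {X : Type u} [MeasurableSpace X] {μ : Measure X} (hμ : IsStandardSigmaFinite μ)
    {α : G → X → X} (hα : ∀ g, MeasurePreserving (α g) μ μ)
    {Z : Type*} [Small.{u} Z] [TopologicalSpace Z] [PolishSpace Z] [LocallyCompactSpace Z]
    [MeasurableSpace Z] [BorelSpace Z] [MulAction G Z] [ContinuousSMul G Z]
    {Φ : X → Z} (hΦ : Measurable Φ) (hinj : Function.Injective Φ)
    (hequiv : ∀ g, ∀ᵐ x ∂μ, Φ (α g x) = g • Φ x)
    (hfin : ∀ z, ∃ U ∈ nhds z, IsOpen U ∧ μ (Φ ⁻¹' U) < ⊤) :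
    ∃ (Y : Type u) (_ : TopologicalSpace Y) (_ : MeasurableSpace Y) (_ : MulAction G Y)
      (η : Measure Y), IsContinuousRadonModel μ α Y η := by
  let e : Z ≃ₜ Shrink.{u} Z := Shrink.homeomorph Z
  let : MeasurableSpace (Shrink.{u} Z) := borel _
  have : BorelSpace (Shrink.{u} Z) := ⟨rfl⟩
  have hsmul : ∀ (g : G) (y : Shrink.{u} Z), g • y = e (g • e.symm y) := fun _ _ => rfl
  have : PolishSpace (Shrink.{u} Z) := e.symm.isClosedEmbedding.polishSpace
  have : LocallyCompactSpace (Shrink.{u} Z) := e.symm.isClosedEmbedding.locallyCompactSpace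
  have : ContinuousSMul G (Shrink.{u} Z) := ⟨by
    simp only [hsmul]
    exact e.continuous.comp (continuous_fst.smul (e.symm.continuous.comp continuous_snd))⟩
  refine ⟨Shrink.{u} Z, _, _, _, _,
    isContinuousRadonModel_map hμ hα (Φ := e ∘ Φ) (e.continuous.measurable.comp hΦ)
      (e.injective.comp hinj) (fun g => (hequiv g).mono fun x hx => ?_) fun y => ?_⟩
  · simp [hsmul, hx]
  · obtain ⟨U, hU, hUo, h⟩ := hfin (e.symm y)
    refine ⟨e.symm ⁻¹' U, e.symm.continuous.continuousAt hU, hUo.preimage e.symm.continuous, ?_⟩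
    rw [← Set.preimage_comp]
    convert h using 3
    ext x
    simp

/-! ### Bounded functions as functionals on `L¹` -/

section BoundedFunctional

variable {Ω : Type*} [MeasurableSpace Ω] {m : Measure Ω}

theorem integrable_bounded_mul_L1 {F : Ω → ℝ} (hF : Measurable F) (hb : ∀ g, ‖F g‖ ≤ 1)
    (φ : Lp ℝ 1 m) : Integrable (fun g => F g * φ g) m :=
  (L1.integrable_coeFn φ).bdd_mul hF.aestronglyMeasurable (.of_forall hb)

theorem norm_integral_bounded_mul_L1_le {F : Ω → ℝ} (hb : ∀ g, ‖F g‖ ≤ 1) (φ : Lp ℝ 1 m) :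
    ‖∫ g, F g * φ g ∂m‖ ≤ ‖φ‖ := by
  rw [L1.norm_eq_integral_norm]
  refine norm_integral_le_of_norm_le (L1.integrable_coeFn φ).norm (.of_forall fun g => ?_)
  rw [norm_mul]
  exact mul_le_of_le_one_left (norm_nonneg _) (hb g)

/-- Integration against a measurable function bounded by `1`, as an element of the unit ball of
the dual of `L¹`. -/
noncomputable def integralFunctional (m : Measure Ω) (F : Ω → ℝ) (hF : Measurable F)
    (hb : ∀ g, ‖F g‖ ≤ 1) : WeakDualBall (Lp ℝ 1 m) :=
  ⟨StrongDual.toWeakDual (LinearMap.mkContinuous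
    { toFun := fun φ => ∫ g, F g * φ g ∂m
      map_add' := fun φ ψ => by
        rw [← integral_add (integrable_bounded_mul_L1 hF hb φ) (integrable_bounded_mul_L1 hF hb ψ)]
        refine integral_congr_ae ((Lp.coeFn_add φ ψ).mono fun g hg => ?_)
        simp only [hg, Pi.add_apply, mul_add]
      map_smul' := fun c φ => by
        rw [RingHom.id_apply, smul_eq_mul, ← integral_const_mul]
        refine integral_congr_ae ((Lp.coeFn_smul c φ).mono fun g hg => ?_)
        simp only [hg, Pi.smul_apply, smul_eq_mul]
        ring }
    1 fun φ => by simpa using norm_integral_bounded_mul_L1_le hb φ),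
    fun φ => norm_integral_bounded_mul_L1_le hb φ⟩

theorem integralFunctional_apply {F : Ω → ℝ} (hF : Measurable F) (hb : ∀ g, ‖F g‖ ≤ 1)
    (φ : Lp ℝ 1 m) : (integralFunctional m F hF hb).1 φ = ∫ g, F g * φ g ∂m := rfl

theorem integralFunctional_indicator {F : Ω → ℝ} (hF : Measurable F) (hb : ∀ g, ‖F g‖ ≤ 1)
    {s : Set Ω} (hs : MeasurableSet s) (hms : m s ≠ ⊤) :
    (integralFunctional m F hF hb).1 (indicatorConstLp 1 hs hms (1 : ℝ)) = ∫ g in s, F g ∂m := by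
  rw [integralFunctional_apply, ← integral_indicator hs]
  refine integral_congr_ae ((indicatorConstLp_coeFn (p := 1) (hs := hs) (hμs := hms) (c := (1 : ℝ))).mono fun g hg => ?_)
  by_cases hgs : g ∈ s <;> simp [hg, hgs]

theorem integrableOn_of_bounded_of_lt_top {F : Ω → ℝ} (hF : Measurable F)
    (hb : ∀ g, ‖F g‖ ≤ 1) {s : Set Ω} (hms : m s < ⊤) : IntegrableOn F s m :=
  Measure.integrableOn_of_bounded hms.ne hF.aestronglyMeasurable (.of_forall hb)

theorem ae_eq_of_integralFunctional_eq [SigmaFinite m] {F F' : Ω → ℝ} (hF : Measurable F)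
    (hb : ∀ g, ‖F g‖ ≤ 1) (hF' : Measurable F') (hb' : ∀ g, ‖F' g‖ ≤ 1)
    (h : integralFunctional m F hF hb = integralFunctional m F' hF' hb') : F =ᵐ[m] F' := by
  refine ae_eq_of_forall_setIntegral_eq_of_sigmaFinite
    (fun s _ hms => integrableOn_of_bounded_of_lt_top hF hb hms)
    (fun s _ hms => integrableOn_of_bounded_of_lt_top hF' hb' hms) fun s hs hms => ?_
  rw [← integralFunctional_indicator hF hb hs hms.ne, h, integralFunctional_indicator]

theorem ae_eq_zero_of_integralFunctional_eq_zero [SigmaFinite m] {F : Ω → ℝ} (hF : Measurable F)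
    (hb : ∀ g, ‖F g‖ ≤ 1) (h : (integralFunctional m F hF hb).1 = 0) : F =ᵐ[m] 0 := by
  refine ae_eq_zero_of_forall_setIntegral_eq_of_sigmaFinite
    (fun s _ hms => integrableOn_of_bounded_of_lt_top hF hb hms) fun s hs hms => ?_
  rw [← integralFunctional_indicator hF hb hs hms.ne, h]
  rfl

end BoundedFunctional

/-! ### The orbit map of a boolean action -/

theorem IsBooleanAction.measurable_inv_apply {G X : Type*} [Group G] [TopologicalSpace G]
    [IsTopologicalGroup G] [MeasurableSpace G] [BorelSpace G] [MeasurableSpace X] {μ : Measure X}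
    {α : G → X → X} (hα : IsBooleanAction μ α) :
    Measurable fun p : G × X => α p.1⁻¹ p.2 :=
  hα.measurable.comp ((measurable_inv.comp measurable_fst).prodMk measurable_snd)

/-- For almost every `x`, the orbit maps of `x` and of `α h x` differ by a translation almost
everywhere. -/
theorem IsBooleanAction.ae_ae_orbit_eq {G X : Type*} [Group G] [TopologicalSpace G]
    [IsTopologicalGroup G] [MeasurableSpace G] [BorelSpace G]
    [MeasurableSpace X] {μ : Measure X} [SFinite μ] {α : G → X → X} (hα : IsBooleanAction μ α)
    (m : Measure G) [SFinite m] {f : X → ℝ} (hf : Measurable f) (h : G) :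
    ∀ᵐ x ∂μ, ∀ᵐ g ∂m, f (α g⁻¹ (α h x)) = f (α (h⁻¹ * g)⁻¹ x) := by
  refine (Measure.ae_ae_comm (p := fun g x => f (α g⁻¹ (α h x)) = f (α (h⁻¹ * g)⁻¹ x)) ?_).1 ?_
  · refine measurableSet_eq_fun ?_ ?_
    · exact hf.comp (hα.measurable_inv_apply.comp
        (measurable_fst.prodMk ((hα.measurePreserving h).measurable.comp measurable_snd)))
    · exact hf.comp (hα.measurable_inv_apply.comp
        (((measurable_const_mul h⁻¹).comp measurable_fst).prodMk measurable_snd))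
  · refine .of_forall fun g => (hα.mul_ae g⁻¹ h).mono fun x hx => ?_
    rw [mul_inv_rev, inv_inv, hx]

theorem mainTheorem7 {G : Type v} [Group G] [TopologicalSpace G] [IsTopologicalGroup G]
    [PolishSpace G] [LocallyCompactSpace G] [MeasurableSpace G] [BorelSpace G]
    {X : Type u} [MeasurableSpace X] (μ : Measure X) (hμ : IsStandardSigmaFinite μ)
    (α : G → X → X) (hα : IsBooleanAction μ α) :
    ∃ (Y : Type u) (_ : TopologicalSpace Y) (_ : MeasurableSpace Y) (_ : MulAction G Y)
      (η : Measure Y), IsContinuousRadonModel μ α Y η := by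
  have := hμ.standardBorel
  have := hμ.sigmaFinite
  have : Fact ((1 : ENNReal) ≠ ⊤) := ⟨ENNReal.one_ne_top⟩
  obtain ⟨f, hfm, hfinj, hfpos, hf1, hfint⟩ := exists_injective_integrable μ
  let m : Measure G := Measure.haar
  have hF2 : Measurable fun p : G × X => f (α p.1⁻¹ p.2) := hfm.comp hα.measurable_inv_apply
  have hF : ∀ x, Measurable fun g => f (α g⁻¹ x) := fun x =>
    hF2.comp (measurable_id.prodMk measurable_const)
  have hb : ∀ x (g : G), ‖f (α g⁻¹ x)‖ ≤ 1 := fun x g => by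
    rw [Real.norm_of_nonneg (hfpos _).le]
    exact hf1 _
  let Φ : X → PuncturedWeakDualBall (Lp ℝ 1 m) := fun x =>
    ⟨integralFunctional m (fun g => f (α g⁻¹ x)) (hF x) (hb x), fun h => by
      obtain ⟨g, hg⟩ := (ae_eq_zero_of_integralFunctional_eq_zero _ _ h).exists
      exact (hfpos _).ne' hg⟩
  have hΦ : ∀ x φ, (Φ x).1.1 φ = ∫ g, f (α g⁻¹ x) * φ g ∂m := fun x φ => rfl
  -- the matrix coefficients `x ↦ Φ x φ` are integrable
  have hsm : ∀ φ : Lp ℝ 1 m, StronglyMeasurable fun p : X × G => f (α p.2⁻¹ p.1) * φ p.2 :=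
    fun φ => ((hF2.comp measurable_swap).mul
      ((Lp.stronglyMeasurable φ).measurable.comp measurable_snd)).stronglyMeasurable
  have hint : ∀ φ : Lp ℝ 1 m, Integrable (fun x => (Φ x).1.1 φ) μ := fun φ => by
    have hmp : ∀ g, MeasurePreserving (α g) μ μ := hα.measurePreserving
    refine Integrable.integral_prod_left (f := fun p : X × G => f (α p.2⁻¹ p.1) * φ p.2)
      ((integrable_prod_iff' (hsm φ).aestronglyMeasurable).2 ⟨.of_forall fun g => ?_, ?_⟩)
    · exact ((hmp g⁻¹).integrable_comp_of_integrable hfint).mul_const (φ g)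
    -- Invariance of `μ` makes the inner integral a constant times `‖φ g‖`.
    · have hnorm : ∀ g, ∫ x, ‖f (α g⁻¹ x) * φ g‖ ∂μ = (∫ x, f x ∂μ) * ‖φ g‖ := fun g => by
        simp only [norm_mul, Real.norm_of_nonneg (hfpos _).le]
        rw [integral_mul_const]
        congr 1
        conv_rhs => rw [← (hmp g⁻¹).map_eq]
        exact (integral_map (hmp g⁻¹).measurable.aemeasurable hfm.aestronglyMeasurable).symm
      simp only [hnorm]
      exact (L1.integrable_coeFn φ).norm.const_mul _
  borelize (PuncturedWeakDualBall (Lp ℝ 1 m))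
  refine exists_isContinuousRadonModel_of_small hμ hα.measurePreserving (Φ := Φ)
    (PuncturedWeakDualBall.measurable_of_eval fun φ =>
      ((hsm φ).integral_prod_right (ν := m)).measurable)
    (fun x y hxy => ?_) (fun h => ?_) fun ℓ => ?_
  -- Haar measure is nonzero, so almost everywhere agreement provides one `g` where the values
  -- agree.
  · obtain ⟨g, hg⟩ := (ae_eq_of_integralFunctional_eq (hF x) (hb x) (hF y) (hb y)
      (congrArg Subtype.val hxy)).exists
    exact (hα.bijective g⁻¹).injective (hfinj hg)
  · filter_upwards [hα.ae_ae_orbit_eq m hfm h] with x hx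
    refine Subtype.ext (Subtype.ext (DFunLike.ext _ _ fun φ => ?_))
    rw [PuncturedWeakDualBall.smul_apply, hΦ, hΦ]
    calc ∫ g, f (α g⁻¹ (α h x)) * φ g ∂m
        = ∫ g, f (α (h⁻¹ * g)⁻¹ x) * φ g ∂m :=
          integral_congr_ae (hx.mono fun g hg => by simp only [hg])
      _ = ∫ g, f (α (h⁻¹ * (h * g))⁻¹ x) * φ (h * g) ∂m :=
          (integral_mul_left_eq_self (fun g => f (α (h⁻¹ * g)⁻¹ x) * φ g) h).symm
      _ = ∫ g, f (α g⁻¹ x) * (DomMulAct.mk h • φ : Lp ℝ 1 m) g ∂m := by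
          refine integral_congr_ae
            ((DomMulAct.smul_Lp_ae_eq (DomMulAct.mk h) φ).mono fun g hg => ?_)
          simp only [hg, inv_mul_cancel_left, Equiv.symm_apply_apply, smul_eq_mul]
  -- Puncturing is used here: some `φ` has `ℓ φ ≠ 0`, and Markov's inequality bounds the measure of
  -- the set where the coefficient exceeds half of `‖ℓ φ‖`.
  · obtain ⟨φ, hφ⟩ := ℓ.exists_apply_ne_zero
    have hcont : Continuous fun ℓ' : PuncturedWeakDualBall (Lp ℝ 1 m) => ‖ℓ'.1.1 φ‖ :=
      ((WeakDualBall.continuous_eval φ).comp continuous_subtype_val).norm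
    have hpos : 0 < ‖ℓ.1.1 φ‖ / 2 := half_pos (norm_pos_iff.2 hφ)
    have hopen := isOpen_lt continuous_const hcont (f := fun _ => ‖ℓ.1.1 φ‖ / 2)
    refine ⟨_, hopen.mem_nhds (half_lt_self (norm_pos_iff.2 hφ)), hopen, ?_⟩
    refine lt_of_le_of_lt (measure_mono ?_) ((hint φ).measure_norm_ge_lt_top hpos)
    exact fun x (hx : ‖ℓ.1.1 φ‖ / 2 < ‖(Φ x).1.1 φ‖) => hx.le
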